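/- For an $n\times m$ real matrix $A$ let $\mathcal R(A)\subseteq\mathbb R^n$ be its range and $\|A\|$ its spectral norm; $A$ is called orthonormal if $A^\top A=I$, and $[A\mid B]$ denotes horizontal concatenation. For a subspace $S\subseteq\mathbb R^n$ of dimension $d\ge 1$ with orthogonal projection $P_S$ let $\mu(S)=\max_{i\in[n]}\frac nd\|P_Se_i\|_2^2$, and put $\mu(A)=\mu(\mathcal R(A))$ for a matrix $A$. For $G\in\mathbb R^{n\times k}$ let $\rho(G)=\frac nk\max_{i\in[n]}\|e_i^\top G\|_2^2$. There are absolute constants $C,c>0$ such that the following holds. Let $k=k(n)\ge 1$ be a sequence of integers with $k=o(n/\log n)$. Then for all sufficiently large $n$ (depending only on the sequence $k$), every $\tau\in(0,1)$, every orthonormal matrix $U\in\mathbb R^{n\times k}$, every $G\in\mathbb R^{n\times k}$ with $\|G\|\le 1$, and a random matrix $H\in\mathbb R^{n\times k}$ with independent $N(0,\tau^2/n)$ entries, the following is true. With probability at least $1-\exp(-cn)-n^{-5}$ there is an orthonormal matrix $Q\in\mathbb R^{n\times 2k}$ such that 1. $\mathcal R(Q)=\mathcal R([U\mid G+H])$,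 and 2. $\mu(Q)\le \dfrac{C}{\tau^2}\bigl(\rho(G)+\mu(U)+\log n\bigr)$. -/

import Mathlib

open Filter Asymptotics MeasureTheory ProbabilityTheory
open scoped Matrix.Norms.L2Operator

noncomputable section

/-- The range (column space) of a real matrix, as a subspace of Euclidean space. -/
def matRange {n : ℕ} {ι : Type*} [Fintype ι] [DecidableEq ι] (A : Matrix (Fin n) ι ℝ) :
    Submodule ℝ (EuclideanSpace ℝ (Fin n)) :=
  LinearMap.range (Matrix.toEuclideanLin A)

/-- The coherence of a subspace `S` of `ℝⁿ`, with `k = dim S`: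
`max_i (n / k) ‖P_S e_i‖²`. -/
def subspaceCoherence {n : ℕ} (S : Submodule ℝ (EuclideanSpace ℝ (Fin n))) : ℝ :=
  ⨆ i : Fin n, ((n : ℝ) / (Module.finrank ℝ S : ℝ)) *
    ‖S.starProjection (EuclideanSpace.single i (1 : ℝ))‖ ^ 2

/-- The coherence `μ(A)` of a matrix, that is, the coherence of its range. -/
def coherence {n : ℕ} {ι : Type*} [Fintype ι] [DecidableEq ι] (A : Matrix (Fin n) ι ℝ) : ℝ :=
  subspaceCoherence (matRange A)

/-- The `ρ`-coherence of an `n × k` matrix: `(n / k) max_i ‖e_iᵀ G‖²`. -/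
def rhoCoherence {n k : ℕ} (G : Matrix (Fin n) (Fin k) ℝ) : ℝ :=
  ((n : ℝ) / (k : ℝ)) * ⨆ i : Fin n, ‖WithLp.toLp 2 (G i)‖ ^ 2

/-- A matrix with orthonormal columns. -/
def IsOrthonormalMatrix {n k : ℕ} (A : Matrix (Fin n) (Fin k) ℝ) : Prop :=
  A.transpose * A = 1

/-- `H ∼ N(0, v)^{n × k}`: the entries of the random matrix `H` are independent centred Gaussian
random variables, each of variance `v`. -/
structure IsGaussianMatrix {Ω : Type*} [MeasurableSpace Ω] (P : Measure Ω) {n k : ℕ} (v : ℝ)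
    (H : Ω → Matrix (Fin n) (Fin k) ℝ) : Prop where
  hasLaw : ∀ i j, HasLaw (fun ω => H ω i j) (gaussianReal 0 v.toNNReal) P
  indep : iIndepFun (fun (p : Fin n × Fin k) (ω : Ω) => H ω p.1 p.2) P

end

/-! Write `A = G + H`, `S = R([U | A])` and `W = (I - UUᵀ)A`. Any vector of `S` is `Wx + Uy'` with
orthogonal summands. Hence if `‖Ax + Uy‖ ≥ s‖x‖` for all `x`, `y`, Cauchy–Schwarz bounds the
leverage score `‖P_S e_i‖²` by `‖W_i‖²/s² + ‖U_i‖²` (`norm_sq_starProjection_fromCols_le`). The row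
`W_i` splits into `G_i`, a part of norm at most `‖U_i‖` since `‖G‖ ≤ 1`, and `k` centred Gaussians
of variance at most `τ²/n`, all of square `O(τ² log n / n)` with high probability. Multiplying by
`n/(2k)` gives the claim with `s = τ/32`.

The lower bound (`IsGaussianMatrix.measure_small_image_le`) comes from a net. For fixed `x`, `y` the
vector `Ax + Uy` is a shifted Gaussian in `ℝⁿ`, so it is shorter than `2η` with probability at most
`(8η/τ)^n`, whatever the shift. The net has only `(44n⁴/η)^(2k)` points, which is `exp(o(n))`
because `k log n = o(n)`, unless `τ` is tiny.

If `τ²n < log n`, the trivial bound `n/(2k) ≤ n < log n / τ²` on the coherence is enough, and only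
linear independence of the columns is needed. The same net estimate with `η → 0` gives it almost
surely, on the event that the entries are bounded. -/

/-! ### Gaussian sums, small balls and tails -/

/-- A linear combination of independent centred Gaussians is Gaussian. -/
theorem hasLaw_weighted_sum {Ω ι : Type*} [MeasurableSpace Ω] {P : Measure Ω} [Fintype ι]
    {X : ι → Ω → ℝ} {v : NNReal} (hX : ∀ i, HasLaw (X i) (gaussianReal 0 v) P)
    (h : iIndepFun X P) (w : ι → ℝ) :
    HasLaw (fun ω => ∑ i, w i * X i ω) (gaussianReal 0 ((∑ i, w i ^ 2).toNNReal * v)) P := by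
  have hP := h.isProbabilityMeasure
  have hg : ∀ i, HasLaw (fun ω => w i * X i ω) (gaussianReal 0 (NNReal.mk (w i ^ 2) (sq_nonneg _) * v)) P :=
    fun i => by simpa using gaussianReal_const_mul (hX i) (w i)
  have hind : iIndepFun (fun i ω => w i * X i ω) P :=
    h.comp (fun i x => w i * x) (fun i => by fun_prop)
  have hG : ∀ i, HasGaussianLaw (fun ω => w i * X i ω) P := fun i => ⟨by
    rw [(hg i).map_eq]; infer_instance⟩
  have hS := iIndepFun.hasGaussianLaw_fun_sum hG hind
  have hm : ∀ i, MemLp (fun ω => w i * X i ω) 2 P := fun i => (hG i).memLp_two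
  have hi : ∀ i, Integrable (fun ω => w i * X i ω) P := fun i => (hG i).integrable
  have hmean : ∀ i, ∫ ω, w i * X i ω ∂P = 0 := fun i => by
    rw [(hg i).integral_eq, integral_id_gaussianReal]
  have hvar : ∀ i, Var[fun ω => w i * X i ω; P] = w i ^ 2 * v := fun i => by
    rw [(hg i).variance_eq, variance_id_gaussianReal]
    rfl
  refine ⟨hS.aemeasurable, ?_⟩
  rw [hS.map_eq_gaussianReal]
  congr 1
  · rw [integral_finsetSum _ (fun i _ => hi i)]
    simp [hmean]
  · have : (fun ω => ∑ i, w i * X i ω) = ∑ i, fun ω => w i * X i ω := by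
      ext ω; simp
    rw [this, IndepFun.variance_sum (fun i _ => hm i) (fun i _ j _ hij => hind.indepFun hij)]
    simp only [hvar]
    rw [← Finset.sum_mul, Real.toNNReal_mul (Finset.sum_nonneg fun i _ => sq_nonneg _)]
    simp

/-- Replacing the density by its maximum leaves a Lebesgue integral, whose translation invariance
removes the shift `a`. -/
theorem lintegral_exp_neg_sq_gaussianReal_le {s : NNReal} (hs : s ≠ 0) {l : ℝ} (hl : 0 < l)
    (a : ℝ) :
    ∫⁻ y, ENNReal.ofReal (Real.exp (-l * (a + y) ^ 2)) ∂(gaussianReal 0 s) ≤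
      ENNReal.ofReal ((Real.sqrt (2 * l * s))⁻¹) := by
  have hs' : (0 : ℝ) < s := by positivity
  rw [gaussianReal_of_var_ne_zero _ hs, lintegral_withDensity_eq_lintegral_mul _
    (measurable_gaussianPDF _ _) (by fun_prop)]
  have hpdf : ∀ y, gaussianPDF 0 s y ≤ ENNReal.ofReal ((Real.sqrt (2 * Real.pi * s))⁻¹) := by
    intro y
    rw [gaussianPDF]
    apply ENNReal.ofReal_le_ofReal
    rw [gaussianPDFReal]
    refine mul_le_of_le_one_right (by positivity) ?_
    rw [Real.exp_le_one_iff, neg_div]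
    exact neg_nonpos.mpr (by positivity)
  calc ∫⁻ y, (gaussianPDF 0 s * fun y => ENNReal.ofReal (Real.exp (-l * (a + y) ^ 2))) y
      ≤ ∫⁻ y, ENNReal.ofReal ((Real.sqrt (2 * Real.pi * s))⁻¹) *
          ENNReal.ofReal (Real.exp (-l * (a + y) ^ 2)) :=
        lintegral_mono fun y => mul_le_mul_left (hpdf y) _
    _ = ENNReal.ofReal ((Real.sqrt (2 * Real.pi * s))⁻¹) *
          ∫⁻ y, ENNReal.ofReal (Real.exp (-l * (a + y) ^ 2)) :=
        lintegral_const_mul _ (by fun_prop)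
    _ = ENNReal.ofReal ((Real.sqrt (2 * Real.pi * s))⁻¹) *
          ∫⁻ y, ENNReal.ofReal (Real.exp (-l * y ^ 2)) := by
        rw [lintegral_add_left_eq_self (fun y => ENNReal.ofReal (Real.exp (-l * y ^ 2))) a]
    _ = ENNReal.ofReal ((Real.sqrt (2 * Real.pi * s))⁻¹ * Real.sqrt (Real.pi / l)) := by
        rw [← ofReal_integral_eq_lintegral_ofReal (integrable_exp_neg_mul_sq hl)
          (Eventually.of_forall fun _ => (Real.exp_pos _).le), integral_gaussian,
          ← ENNReal.ofReal_mul (by positivity)]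
    _ = _ := by
        congr 1
        rw [← Real.sqrt_inv, ← Real.sqrt_inv, ← Real.sqrt_mul (by positivity)]
        congr 1
        have := Real.pi_pos
        field_simp

/-- Small ball estimate for a shifted Gaussian vector. -/
theorem gaussian_small_ball {Ω : Type*} [MeasurableSpace Ω] {P : Measure Ω} {n : ℕ} (hn : 1 ≤ n)
    {Y : Fin n → Ω → ℝ} {s : NNReal} (hs : s ≠ 0)
    (hY : ∀ i, HasLaw (Y i) (gaussianReal 0 s) P) (h : iIndepFun Y P) (a : Fin n → ℝ)
    {t : ℝ} (ht : 0 < t) :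
    P {ω | ∑ i, (a i + Y i ω) ^ 2 ≤ t} ≤
      ENNReal.ofReal (Real.sqrt (Real.exp 1 * t / (n * s)) ^ n) := by
  have hs' : (0 : ℝ) < s := by positivity
  have hn' : (0 : ℝ) < n := by positivity
  have hlaw := h.hasLaw_pi hY
  -- This `l` minimises the exponential Markov bound `exp(l t) (2 l s)^(-n/2)`.
  set l : ℝ := n / (2 * t) with hl
  have hlpos : 0 < l := by positivity
  have hpi : iIndepFun (fun (i : Fin n) (y : Fin n → ℝ) =>
      ENNReal.ofReal (Real.exp (-l * (a i + y i) ^ 2)))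
      (Measure.pi fun _ : Fin n => gaussianReal 0 s) :=
    iIndepFun_pi (X := fun i y => ENNReal.ofReal (Real.exp (-l * (a i + y) ^ 2)))
      (fun i => by fun_prop)
  have hint : ∫⁻ y, ∏ i, ENNReal.ofReal (Real.exp (-l * (a i + y i) ^ 2))
      ∂(Measure.pi fun _ : Fin n => gaussianReal 0 s) ≤
      ENNReal.ofReal ((Real.sqrt (2 * l * s))⁻¹) ^ n := by
    rw [lintegral_prod_eq_prod_lintegral_of_indepFun _ _ hpi (fun i => by fun_prop)]
    refine (Finset.prod_le_pow_card _ _ (ENNReal.ofReal ((Real.sqrt (2 * l * s))⁻¹))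
      fun i _ => ?_).trans (by simp)
    rw [(measurePreserving_eval (fun _ : Fin n => gaussianReal 0 s) i).lintegral_comp
      (f := fun y => ENNReal.ofReal (Real.exp (-l * (a i + y) ^ 2))) (by fun_prop)]
    exact lintegral_exp_neg_sq_gaussianReal_le hs hlpos (a i)
  have hprod : ∀ y : Fin n → ℝ, ∏ i, ENNReal.ofReal (Real.exp (-l * (a i + y i) ^ 2)) =
      ENNReal.ofReal (Real.exp (-l * ∑ i, (a i + y i) ^ 2)) := fun y => by
    rw [← ENNReal.ofReal_prod_of_nonneg (fun i _ => (Real.exp_pos _).le), ← Real.exp_sum,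
      Finset.mul_sum]
  simp only [hprod] at hint
  have hmeas : MeasurableSet {y : Fin n → ℝ | ∑ i, (a i + y i) ^ 2 ≤ t} :=
    measurableSet_le (by fun_prop) (by fun_prop)
  rw [hlaw.measure_eq (p := fun y => ∑ i, (a i + y i) ^ 2 ≤ t) hmeas]
  have hmeas' : AEMeasurable (fun y : Fin n → ℝ =>
      ENNReal.ofReal (Real.exp (-l * ∑ i, (a i + y i) ^ 2)))
      (Measure.pi fun _ : Fin n => gaussianReal 0 s) := by
    refine Measurable.aemeasurable ?_
    fun_prop
  have hsub : {y : Fin n → ℝ | ∑ i, (a i + y i) ^ 2 ≤ t} ⊆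
      {y | ENNReal.ofReal (Real.exp (-l * t)) ≤
        ENNReal.ofReal (Real.exp (-l * ∑ i, (a i + y i) ^ 2))} := by
    intro y hy
    apply ENNReal.ofReal_le_ofReal
    apply Real.exp_le_exp.mpr
    have := mul_le_mul_of_nonneg_left (Set.mem_ofPred_eq ▸ hy) hlpos.le
    linarith
  refine (measure_mono hsub).trans ((meas_ge_le_lintegral_div hmeas' (by simp [Real.exp_pos])
    ENNReal.ofReal_ne_top).trans ?_)
  refine (ENNReal.div_le_div_right hint _).trans ?_
  rw [← ENNReal.ofReal_pow (by positivity), ← ENNReal.ofReal_div_of_pos (Real.exp_pos _)]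
  apply ENNReal.ofReal_le_ofReal
  apply le_of_eq
  have hlt : -l * t = -(n * (1 / 2)) := by rw [hl]; field_simp
  rw [hlt, Real.exp_neg, div_inv_eq_mul, Real.exp_nat_mul, ← mul_pow]
  congr 1
  have h2 : 2 * l * s = n * s / t := by rw [hl]; field_simp
  rw [h2, Real.exp_half, ← Real.sqrt_inv, ← Real.sqrt_mul (by positivity)]
  congr 1
  field_simp

/-- Only an upper bound `s'` on the variance enters, so the degenerate case `s = 0` is covered. -/
theorem gaussian_tail {Ω : Type*} [MeasurableSpace Ω] {P : Measure Ω}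
    {Y : Ω → ℝ} {s : NNReal} (hY : HasLaw Y (gaussianReal 0 s) P) {s' : ℝ} (hs : s ≤ s')
    {L : ℝ} (hL : 0 ≤ L) :
    P {ω | L ≤ |Y ω|} ≤ ENNReal.ofReal (2 * Real.exp (-L ^ 2 / (2 * s'))) := by
  have hP : IsProbabilityMeasure P := hY.isProbabilityMeasure
  have hs0 : 0 ≤ s' := s.2.trans hs
  have hsub : HasSubgaussianMGF Y (NNReal.mk s' hs0) P := by
    constructor
    · intro t
      have := integrable_exp_mul_gaussianReal (μ := 0) (v := s) t
      rw [← hY.map_eq] at this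
      exact this.comp_aemeasurable hY.aemeasurable
    · intro t
      rw [mgf_gaussianReal hY.map_eq]
      apply Real.exp_le_exp.mpr
      have : (s : ℝ) * t ^ 2 ≤ s' * t ^ 2 := by gcongr
      simp only [NNReal.coe_mk]
      linarith
  have h1 := hsub.measure_ge_le hL
  have h2 := hsub.neg.measure_ge_le hL
  have hu : {ω | L ≤ |Y ω|} ⊆ {ω | L ≤ Y ω} ∪ {ω | L ≤ (-Y) ω} := fun ω hω => by
    simpa [le_abs] using hω
  refine (measure_mono hu).trans ((measure_union_le _ _).trans ?_)
  rw [two_mul, ENNReal.ofReal_add (Real.exp_pos _).le (Real.exp_pos _).le]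
  refine add_le_add ?_ ?_
  · rw [← ofReal_measureReal]
    exact ENNReal.ofReal_le_ofReal h1
  · rw [← ofReal_measureReal]
    exact ENNReal.ofReal_le_ofReal h2

/-- The rows of a Gaussian matrix, paired with a fixed vector, are independent. -/
theorem IsGaussianMatrix.iIndepFun_rows {Ω : Type*} [MeasurableSpace Ω] {P : Measure Ω}
    {n k : ℕ} {v : ℝ} {H : Ω → Matrix (Fin n) (Fin k) ℝ}
    (hH : IsGaussianMatrix P v H) (x : Fin k → ℝ) :
    iIndepFun (fun i ω => ∑ j, x j * H ω i j) P := by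
  have hP := hH.indep.isProbabilityMeasure
  have hrow : ∀ i, HasLaw (fun ω j => H ω i j)
      (Measure.pi fun _ : Fin k => gaussianReal 0 v.toNNReal) P := fun i =>
    (hH.indep.precomp (g := fun j => (i, j)) (fun a b hab => by simpa using hab)).hasLaw_pi
      (fun j => hH.hasLaw i j)
  have hall := hH.indep.hasLaw_pi (fun p : Fin n × Fin k => hH.hasLaw p.1 p.2)
  -- The product measure over pairs is the iterated product measure; it suffices to compare them on
  -- boxes.
  have hcurry : (Measure.pi fun _ : Fin n × Fin k => gaussianReal 0 v.toNNReal) =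
      (Measure.pi fun _ : Fin n => Measure.pi fun _ : Fin k => gaussianReal 0 v.toNNReal).map
        (fun y p => y p.1 p.2) := by
    apply Measure.pi_eq
    intro s hs
    rw [Measure.map_apply (by fun_prop) (MeasurableSet.univ_pi hs)]
    have : (fun (y : Fin n → Fin k → ℝ) (p : Fin n × Fin k) => y p.1 p.2) ⁻¹' Set.univ.pi s =
        Set.univ.pi fun i => Set.univ.pi fun j => s (i, j) := by
      ext y; simp
    rw [this, Measure.pi_pi]
    simp only [Measure.pi_pi]
    rw [Fintype.prod_prod_type]
  have hc : Measurable (fun (y : Fin n × Fin k → ℝ) (i : Fin n) (j : Fin k) => y (i, j)) := by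
    fun_prop
  have hlaw : HasLaw (fun ω i j => H ω i j)
      (Measure.pi fun _ : Fin n => Measure.pi fun _ : Fin k => gaussianReal 0 v.toNNReal) P := by
    refine HasLaw.fun_comp (Y := fun (y : Fin n × Fin k → ℝ) (i : Fin n) (j : Fin k) => y (i, j))
      ⟨hc.aemeasurable, ?_⟩ hall
    rw [hcurry, Measure.map_map hc (by fun_prop)]
    exact Measure.map_id
  have := (iIndepFun_iff_hasLaw_pi_pi hrow).2 hlaw
  exact this.comp (fun _ y => ∑ j, x j * y j) (fun _ => by fun_prop)

/-! ### Discretisation to a grid of mesh `1 / D` -/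

theorem abs_sub_floor_div_le {D : ℕ} (hD : 0 < D) (x : ℝ) :
    |x - (⌊D * x⌋ : ℝ) / D| ≤ 1 / D := by
  have hD' : (0 : ℝ) < D := by exact_mod_cast hD
  have h1 := Int.floor_le (D * x)
  have h2 := Int.lt_floor_add_one (D * x)
  have : x - (⌊D * x⌋ : ℝ) / D = (D * x - ⌊D * x⌋) / D := by field_simp
  rw [this, abs_div, abs_of_pos hD']
  gcongr
  rw [abs_le]; constructor <;> linarith

theorem abs_mulVec_le {n k : ℕ} {A : Matrix (Fin n) (Fin k) ℝ} {a b : ℝ}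
    (hA : ∀ i j, |A i j| ≤ a) {x : Fin k → ℝ} (hx : ∀ j, |x j| ≤ b) (i : Fin n) :
    |A.mulVec x i| ≤ k * (a * b) := by
  rw [Matrix.mulVec, dotProduct]
  refine (Finset.abs_sum_le_sum_abs _ _).trans ?_
  refine (Finset.sum_le_card_nsmul _ _ (a * b) fun j _ => ?_).trans (by simp)
  rw [abs_mul]
  exact mul_le_mul (hA i j) (hx j) (abs_nonneg _) ((abs_nonneg _).trans (hA i j))

theorem IsOrthonormalMatrix.sum_mulVec_sq {n k : ℕ} {U : Matrix (Fin n) (Fin k) ℝ}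
    (hU : IsOrthonormalMatrix U) (y : Fin k → ℝ) :
    ∑ i, (U.mulVec y i) ^ 2 = ∑ j, y j ^ 2 := by
  have h : U.mulVec y ⬝ᵥ U.mulVec y = y ⬝ᵥ y := by
    rw [Matrix.dotProduct_mulVec, Matrix.vecMul_mulVec, hU, Matrix.vecMul_one]
  simpa [dotProduct, pow_two] using h

theorem IsOrthonormalMatrix.abs_apply_le {n k : ℕ} {U : Matrix (Fin n) (Fin k) ℝ}
    (hU : IsOrthonormalMatrix U) (i : Fin n) (j : Fin k) : |U i j| ≤ 1 := by
  have h := hU.sum_mulVec_sq (Pi.single j 1)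
  have h2 : ∑ l, (Pi.single j (1 : ℝ) : Fin k → ℝ) l ^ 2 = 1 := by
    rw [Finset.sum_eq_single j] <;> simp +contextual
  simp only [Matrix.mulVec_single_one, Matrix.col_apply] at h
  rw [h2] at h
  have := Finset.single_le_sum (f := fun i => U i j ^ 2) (fun i _ => sq_nonneg _)
    (Finset.mem_univ i)
  rw [h] at this
  exact (sq_le_one_iff_abs_le_one _).mp this

/-- The integer grid points of the cube of side `2 K`. -/
noncomputable def gridBox (k K : ℕ) : Finset (Fin k → ℤ) :=
  Fintype.piFinset fun _ => Finset.Icc (-(K : ℤ)) K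

theorem card_gridBox (k K : ℕ) : (gridBox k K).card = (2 * K + 1) ^ k := by
  simp only [gridBox, Fintype.card_piFinset, Int.card_Icc, Finset.prod_const, Finset.card_univ,
    Fintype.card_fin]
  congr 1
  omega

theorem floor_mem_gridBox {k K D : ℕ} {x : Fin k → ℝ} {b : ℝ} (hx : ∀ j, |x j| ≤ b)
    (hK : D * b + 1 ≤ K) : (fun j => ⌊D * x j⌋) ∈ gridBox k K := by
  rw [gridBox, Fintype.mem_piFinset]
  intro j
  have hj := abs_le.mp (hx j)
  have h1 := mul_le_mul_of_nonneg_left hj.1 (Nat.cast_nonneg (α := ℝ) D)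
  have h2 := mul_le_mul_of_nonneg_left hj.2 (Nat.cast_nonneg (α := ℝ) D)
  have h3 := Int.floor_le (D * x j)
  have h4 := Int.lt_floor_add_one (D * x j)
  rw [Finset.mem_Icc]
  constructor
  · have : ((-(K : ℤ) : ℤ) : ℝ) ≤ (⌊D * x j⌋ : ℝ) := by push_cast; linarith
    exact_mod_cast this
  · have : (⌊D * x j⌋ : ℝ) ≤ ((K : ℤ) : ℝ) := by push_cast; linarith
    exact_mod_cast this

/-- If `A x + U y` is small for some unit vector `x`, then it is small at a grid point. -/
theorem exists_grid_point {n k : ℕ} (hk : k ≤ n) {A U : Matrix (Fin n) (Fin k) ℝ}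
    (hU : IsOrthonormalMatrix U) (hA : ∀ i j, |A i j| ≤ 2) {D : ℕ} {η : ℝ} (hη : 0 < η)
    (hη1 : η ≤ 1) (hD : 3 * n ^ 2 ≤ η * D) {x y : Fin k → ℝ} (hx : ∑ j, x j ^ 2 = 1)
    (hxy : ∑ i, (A.mulVec x i + U.mulVec y i) ^ 2 ≤ η ^ 2) :
    ∃ p ∈ gridBox k (5 * n ^ 2 * D) ×ˢ gridBox k (5 * n ^ 2 * D),
      (1 : ℝ) / 4 ≤ ∑ j, ((p.1 j : ℝ) / D) ^ 2 ∧
      ∑ i, (A.mulVec (fun j => (p.1 j : ℝ) / D) i + U.mulVec (fun j => (p.2 j : ℝ) / D) i) ^ 2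
        ≤ (2 * η) ^ 2 := by
  have hkpos : 0 < k := by
    rcases Nat.eq_zero_or_pos k with rfl | h
    · simp at hx
    · exact h
  have hn : (1 : ℝ) ≤ n := by exact_mod_cast (hkpos.trans_le hk)
  have hkn : (k : ℝ) ≤ n := by exact_mod_cast hk
  have hk0 : (0 : ℝ) ≤ k := Nat.cast_nonneg k
  have hn2 : (n : ℝ) ≤ n ^ 2 := by nlinarith
  have hDpos' : (3 : ℝ) * n ^ 2 ≤ D := hD.trans (by
    nlinarith [Nat.cast_nonneg (α := ℝ) D])
  have hDpos : (0 : ℝ) < D := by nlinarith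
  have hD0 : 0 < D := by exact_mod_cast hDpos
  have hx1 : ∀ j, |x j| ≤ 1 := fun j => by
    have := Finset.single_le_sum (f := fun j => x j ^ 2) (fun j _ => sq_nonneg _)
      (Finset.mem_univ j)
    rw [hx] at this
    exact (sq_le_one_iff_abs_le_one _).mp this
  have hAx : ∀ i, |A.mulVec x i| ≤ k * (2 * 1) := abs_mulVec_le hA hx1
  have hU1 := hU.abs_apply_le
  -- A priori bound on `y`: `U` is an isometry and `Uy` is the small vector `Ax + Uy` minus the
  -- bounded vector `Ax`.
  have hysum : ∑ j, y j ^ 2 ≤ (4 * n ^ 2) ^ 2 := by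
    rw [← hU.sum_mulVec_sq y]
    calc ∑ i, (U.mulVec y i) ^ 2
        ≤ ∑ i, (2 * (A.mulVec x i + U.mulVec y i) ^ 2 + 8 * (n : ℝ) ^ 2) := by
          refine Finset.sum_le_sum fun i _ => ?_
          have h1 : (A.mulVec x i) ^ 2 ≤ (2 * n) ^ 2 :=
            sq_le_sq' (by linarith [(abs_le.mp (hAx i)).1]) (by linarith [(abs_le.mp (hAx i)).2])
          nlinarith [sq_nonneg (A.mulVec x i + U.mulVec y i + A.mulVec x i)]
      _ = 2 * ∑ i, (A.mulVec x i + U.mulVec y i) ^ 2 + n * (8 * (n : ℝ) ^ 2) := by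
          rw [Finset.sum_add_distrib, ← Finset.mul_sum]; simp
      _ ≤ 2 * 1 + 8 * (n : ℝ) ^ 3 := by
          have : η ^ 2 ≤ 1 := by nlinarith
          nlinarith
      _ ≤ (4 * n ^ 2) ^ 2 := by
          have : (n : ℝ) ^ 3 ≤ n ^ 4 := pow_le_pow_right₀ hn (by norm_num)
          have : (1 : ℝ) ≤ n ^ 4 := one_le_pow₀ hn
          nlinarith
  have hy1 : ∀ j, |y j| ≤ 4 * n ^ 2 := fun j => by
    have := Finset.single_le_sum (f := fun j => y j ^ 2) (fun j _ => sq_nonneg _)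
      (Finset.mem_univ j)
    exact abs_le_of_sq_le_sq (this.trans hysum) (by positivity)
  have hDn : (1 : ℝ) ≤ n ^ 2 * D := by nlinarith
  set x' : Fin k → ℝ := fun j => (⌊D * x j⌋ : ℝ) / D with hx'
  set y' : Fin k → ℝ := fun j => (⌊D * y j⌋ : ℝ) / D with hy'
  have hdx : ∀ j, |(x - x') j| ≤ 1 / D := fun j => abs_sub_floor_div_le hD0 (x j)
  have hdy : ∀ j, |(y - y') j| ≤ 1 / D := fun j => abs_sub_floor_div_le hD0 (y j)
  refine ⟨(fun j => ⌊D * x j⌋, fun j => ⌊D * y j⌋), ?_, ?_, ?_⟩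
  · rw [Finset.mem_product]
    exact ⟨floor_mem_gridBox hx1 (by push_cast; nlinarith),
      floor_mem_gridBox hy1 (by push_cast; nlinarith)⟩
  -- Rounding costs little length: `1 ≤ 2‖x'‖² + 2/9`, so `‖x'‖² ≥ 7/18`.
  · have h1 : ∑ j, x j ^ 2 ≤ 2 * ∑ j, x' j ^ 2 + k * (2 * (1 / D) ^ 2) := by
      calc ∑ j, x j ^ 2 ≤ ∑ j, (2 * x' j ^ 2 + 2 * (1 / (D : ℝ)) ^ 2) := by
            refine Finset.sum_le_sum fun j _ => ?_
            have h1 : ((x - x') j) ^ 2 ≤ (1 / (D : ℝ)) ^ 2 := sq_le_sq.mpr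
              ((hdx j).trans (le_abs_self _))
            rw [Pi.sub_apply] at h1
            nlinarith [sq_nonneg (x j - x' j - x' j)]
        _ = _ := by rw [Finset.sum_add_distrib, ← Finset.mul_sum]; simp
    rw [hx] at h1
    have h2 : k * (2 * (1 / (D : ℝ)) ^ 2) ≤ 2 / 9 := by
      have h3 : (1 : ℝ) / D ≤ 1 / (3 * n ^ 2) := by gcongr
      have h4 : (1 / (D : ℝ)) ^ 2 ≤ (1 / (3 * n ^ 2)) ^ 2 := by gcongr
      calc k * (2 * (1 / (D : ℝ)) ^ 2) ≤ n * (2 * (1 / (3 * (n : ℝ) ^ 2)) ^ 2) := by gcongr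
        _ = 2 / 9 * (1 / (n : ℝ) ^ 3) := by field_simp; norm_num
        _ ≤ 2 / 9 * 1 := by
          gcongr
          rw [div_le_one (by positivity)]
          exact one_le_pow₀ hn
        _ = _ := by norm_num
    change (1 : ℝ) / 4 ≤ ∑ j, x' j ^ 2
    linarith
  · change ∑ i, (A.mulVec x' i + U.mulVec y' i) ^ 2 ≤ (2 * η) ^ 2
    have hδ : ∀ i, |A.mulVec (x - x') i + U.mulVec (y - y') i| ≤ 3 * n / D := fun i => by
      refine (abs_add_le _ _).trans ?_
      have h1 := abs_mulVec_le hA hdx i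
      have h2 := abs_mulVec_le hU1 hdy i
      calc _ ≤ k * (2 * (1 / (D : ℝ))) + k * (1 * (1 / D)) := add_le_add h1 h2
        _ = 3 * k / D := by ring
        _ ≤ _ := by gcongr
    have hδ2 : (n : ℝ) * (3 * n / D) ^ 2 ≤ η ^ 2 := by
      have h1 : 3 * (n : ℝ) ^ 2 / D ≤ η := by rwa [div_le_iff₀ hDpos]
      calc (n : ℝ) * (3 * n / D) ^ 2 ≤ (n : ℝ) ^ 2 * (3 * n / D) ^ 2 := by gcongr
        _ = (3 * (n : ℝ) ^ 2 / D) ^ 2 := by ring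
        _ ≤ _ := by gcongr
    calc ∑ i, (A.mulVec x' i + U.mulVec y' i) ^ 2
        ≤ ∑ i, (2 * (A.mulVec x i + U.mulVec y i) ^ 2 + 2 * (3 * (n : ℝ) / D) ^ 2) := by
          refine Finset.sum_le_sum fun i _ => ?_
          have h1 : (A.mulVec (x - x') i + U.mulVec (y - y') i) ^ 2 ≤ (3 * (n : ℝ) / D) ^ 2 :=
            sq_le_sq.mpr ((hδ i).trans (le_abs_self _))
          rw [Matrix.mulVec_sub, Matrix.mulVec_sub, Pi.sub_apply, Pi.sub_apply] at h1
          nlinarith [sq_nonneg (A.mulVec x i + U.mulVec y i +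
            (A.mulVec x i - A.mulVec x' i + (U.mulVec y i - U.mulVec y' i)))]
      _ = 2 * ∑ i, (A.mulVec x i + U.mulVec y i) ^ 2 + 2 * (n * (3 * (n : ℝ) / D) ^ 2) := by
          rw [Finset.sum_add_distrib, ← Finset.mul_sum]; simp; ring
      _ ≤ (2 * η) ^ 2 := by nlinarith

/-! ### Least singular value by a union bound -/

/-- The coordinates are independent Gaussians of variance `‖x‖²τ²/n`, shifted by `Gx + Uy`. The
lower bound on `‖x‖` keeps this variance of order `τ²/n`. -/
theorem IsGaussianMatrix.grid_point_small_ball {Ω : Type*} [MeasurableSpace Ω] {P : Measure Ω}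
    {n k : ℕ} (hn : 1 ≤ n) {τ : ℝ} (hτ : 0 < τ) {H : Ω → Matrix (Fin n) (Fin k) ℝ}
    (hH : IsGaussianMatrix P (τ ^ 2 / n) H) (U G : Matrix (Fin n) (Fin k) ℝ) (x y : Fin k → ℝ)
    (hx : (1 : ℝ) / 4 ≤ ∑ j, x j ^ 2) {η : ℝ} (hη : 0 < η) :
    P {ω | ∑ i, ((G + H ω).mulVec x i + U.mulVec y i) ^ 2 ≤ (2 * η) ^ 2} ≤
      ENNReal.ofReal ((8 * η / τ) ^ n) := by
  have hn' : (0 : ℝ) < n := by positivity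
  have hS : 0 < ∑ j, x j ^ 2 := by linarith
  have hlaw : ∀ i, HasLaw (fun ω => ∑ j, x j * H ω i j)
      (gaussianReal 0 ((∑ j, x j ^ 2).toNNReal * (τ ^ 2 / n).toNNReal)) P := fun i =>
    hasLaw_weighted_sum (fun j => hH.hasLaw i j)
      (hH.indep.precomp (g := fun j => (i, j)) (fun a b hab => by simpa using hab)) x
  have hv : 0 < τ ^ 2 / n := by positivity
  have hs : (∑ j, x j ^ 2).toNNReal * (τ ^ 2 / n).toNNReal ≠ 0 :=
    (mul_pos (Real.toNNReal_pos.mpr hS) (Real.toNNReal_pos.mpr hv)).ne'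
  have hb := gaussian_small_ball hn hs hlaw (hH.iIndepFun_rows x)
    (fun i => G.mulVec x i + U.mulVec y i) (t := (2 * η) ^ 2) (by positivity)
  have hset : {ω | ∑ i, ((G + H ω).mulVec x i + U.mulVec y i) ^ 2 ≤ (2 * η) ^ 2} =
      {ω | ∑ i, (G.mulVec x i + U.mulVec y i + ∑ j, x j * H ω i j) ^ 2 ≤ (2 * η) ^ 2} := by
    ext ω
    have : ∀ i, (G + H ω).mulVec x i + U.mulVec y i =
        G.mulVec x i + U.mulVec y i + ∑ j, x j * H ω i j := fun i => by
      have : (H ω).mulVec x i = ∑ j, x j * H ω i j := by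
        simp [Matrix.mulVec, dotProduct, mul_comm]
      rw [Matrix.add_mulVec, Pi.add_apply, this]; ring
    simp only [Set.mem_ofPred_eq, this]
  rw [hset]
  refine hb.trans (ENNReal.ofReal_le_ofReal ?_)
  gcongr
  rw [Real.sqrt_le_left (by positivity)]
  push_cast
  rw [Real.coe_toNNReal _ hS.le, Real.coe_toNNReal _ hv.le]
  have he := Real.exp_one_lt_d9
  calc Real.exp 1 * (2 * η) ^ 2 / (n * ((∑ j, x j ^ 2) * (τ ^ 2 / n)))
      = Real.exp 1 * 4 * η ^ 2 / ((∑ j, x j ^ 2) * τ ^ 2) := by field_simp; norm_num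
    _ ≤ 4 * 4 * η ^ 2 / (1 / 4 * τ ^ 2) := by gcongr; linarith
    _ = (8 * η / τ) ^ 2 := by field_simp; norm_num

/-- Least singular value estimate for `[G + H | U]` in the `G + H` directions. -/
theorem IsGaussianMatrix.measure_small_image_le {Ω : Type*} [MeasurableSpace Ω] {P : Measure Ω}
    {n k : ℕ} (hn : 1 ≤ n) (hk : k ≤ n) {τ : ℝ} (hτ : 0 < τ) {H : Ω → Matrix (Fin n) (Fin k) ℝ}
    (hH : IsGaussianMatrix P (τ ^ 2 / n) H) {U : Matrix (Fin n) (Fin k) ℝ}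
    (hU : IsOrthonormalMatrix U) (G : Matrix (Fin n) (Fin k) ℝ) {η : ℝ} (hη : 0 < η)
    (hη1 : η ≤ 1) :
    P {ω | (∀ i j, |(G + H ω) i j| ≤ 2) ∧ ∃ x y : Fin k → ℝ, ∑ j, x j ^ 2 = 1 ∧
        ∑ i, ((G + H ω).mulVec x i + U.mulVec y i) ^ 2 ≤ η ^ 2} ≤
      ENNReal.ofReal ((44 * n ^ 4 / η) ^ (2 * k) * (8 * η / τ) ^ n) := by
  have hn' : (1 : ℝ) ≤ n := by exact_mod_cast hn
  set D : ℕ := ⌈3 * (n : ℝ) ^ 2 / η⌉₊ with hD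
  have hD1 : 3 * (n : ℝ) ^ 2 ≤ η * D := by
    have := Nat.le_ceil (3 * (n : ℝ) ^ 2 / η)
    rw [div_le_iff₀ hη] at this
    linarith
  have hnη : 1 ≤ (n : ℝ) ^ 2 / η := by
    rw [one_le_div hη]; exact hη1.trans (one_le_pow₀ hn')
  have hD2 : (D : ℝ) ≤ 4 * n ^ 2 / η := by
    have := Nat.ceil_lt_add_one (show 0 ≤ 3 * (n : ℝ) ^ 2 / η by positivity)
    have e1 : 4 * (n : ℝ) ^ 2 / η = 3 * n ^ 2 / η + n ^ 2 / η := by ring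
    rw [← hD] at this
    linarith
  set N := gridBox k (5 * n ^ 2 * D) ×ˢ gridBox k (5 * n ^ 2 * D) with hN
  -- Grid points with short `x` are dropped, as the small ball bound fails for them.
  set N' := N.filter fun p => (1 : ℝ) / 4 ≤ ∑ j, ((p.1 j : ℝ) / D) ^ 2
  have hcard : (N.card : ℝ) ≤ (44 * n ^ 4 / η) ^ (2 * k) := by
    rw [hN, Finset.card_product, card_gridBox, ← pow_two, ← pow_mul, mul_comm k 2]
    push_cast
    gcongr
    have h1 : (n : ℝ) ^ 2 * D ≤ 4 * n ^ 4 / η := by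
      calc (n : ℝ) ^ 2 * D ≤ n ^ 2 * (4 * n ^ 2 / η) := by gcongr
        _ = _ := by ring
    have h2 : (1 : ℝ) ≤ n ^ 4 / η := by
      rw [one_le_div hη]; exact hη1.trans (one_le_pow₀ hn')
    have e1 : 44 * (n : ℝ) ^ 4 / η = 44 * (n ^ 4 / η) := by ring
    have e2 : 4 * (n : ℝ) ^ 4 / η = 4 * (n ^ 4 / η) := by ring
    rw [e1]; rw [e2] at h1
    linarith
  have hsub : {ω | (∀ i j, |(G + H ω) i j| ≤ 2) ∧ ∃ x y : Fin k → ℝ, ∑ j, x j ^ 2 = 1 ∧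
        ∑ i, ((G + H ω).mulVec x i + U.mulVec y i) ^ 2 ≤ η ^ 2} ⊆
      ⋃ p ∈ N', {ω | ∑ i, ((G + H ω).mulVec (fun j => (p.1 j : ℝ) / D) i +
        U.mulVec (fun j => (p.2 j : ℝ) / D) i) ^ 2 ≤ (2 * η) ^ 2} := by
    rintro ω ⟨hA, x, y, hx, hxy⟩
    obtain ⟨p, hp, hp1, hp2⟩ := exists_grid_point hk hU hA hη hη1 hD1 hx hxy
    exact Set.mem_biUnion (Finset.mem_filter.mpr ⟨hp, hp1⟩) hp2
  refine (measure_mono hsub).trans ((measure_biUnion_finset_le _ _).trans ?_)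
  refine (Finset.sum_le_card_nsmul _ _ (ENNReal.ofReal ((8 * η / τ) ^ n)) fun p hp =>
    hH.grid_point_small_ball hn hτ U G _ _ (Finset.mem_filter.mp hp).2 hη).trans ?_
  rw [nsmul_eq_mul, ← ENNReal.ofReal_natCast, ← ENNReal.ofReal_mul (Nat.cast_nonneg _)]
  apply ENNReal.ofReal_le_ofReal
  gcongr
  refine le_trans ?_ hcard
  exact_mod_cast Finset.card_filter_le _ _

/-! ### Ranges, dimensions and orthonormal bases -/

theorem exists_isOrthonormalMatrix_of_finrank {n m : ℕ}
    (S : Submodule ℝ (EuclideanSpace ℝ (Fin n))) (hS : Module.finrank ℝ S = m) :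
    ∃ Q : Matrix (Fin n) (Fin m) ℝ, IsOrthonormalMatrix Q ∧ matRange Q = S := by
  let b := (stdOrthonormalBasis ℝ S).reindex (finCongr hS)
  have happ : ∀ z : EuclideanSpace ℝ (Fin m),
      Matrix.toEuclideanLin (Matrix.of fun i j => (b j : EuclideanSpace ℝ (Fin n)) i) z =
        ((∑ j, z j • b j : S) : EuclideanSpace ℝ (Fin n)) := fun z => by
    ext i
    simp [Matrix.toLpLin_apply, Matrix.mulVec, dotProduct, mul_comm]
  refine ⟨Matrix.of fun i j => (b j : EuclideanSpace ℝ (Fin n)) i, ?_, ?_⟩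
  · ext j l
    have h := orthonormal_iff_ite.mp b.orthonormal j l
    rw [Submodule.coe_inner, PiLp.inner_apply] at h
    simp only [Matrix.mul_apply, Matrix.transpose_apply, Matrix.of_apply, Matrix.one_apply]
    rw [← h]
    simp [mul_comm]
  · apply le_antisymm
    · rintro _ ⟨z, rfl⟩
      rw [happ]
      exact Submodule.coe_mem _
    · intro p hp
      refine ⟨WithLp.toLp 2 fun j => b.repr ⟨p, hp⟩ j, ?_⟩
      rw [happ]
      have := b.sum_repr ⟨p, hp⟩
      exact congrArg Subtype.val this

theorem finrank_matRange {n : ℕ} {ι : Type*} [Fintype ι] [DecidableEq ι] (A : Matrix (Fin n) ι ℝ)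
    (hA : ∀ z, A.mulVec z = 0 → z = 0) : Module.finrank ℝ (matRange A) = Fintype.card ι := by
  have hinj : Function.Injective (Matrix.toEuclideanLin A) := by
    rw [injective_iff_map_eq_zero]
    intro z hz
    rw [Matrix.toLpLin_apply] at hz
    have := hA z.ofLp (by simpa using hz)
    ext i
    simpa using congrFun this i
  rw [matRange, LinearMap.finrank_range_of_inj hinj, finrank_euclideanSpace]

theorem IsOrthonormalMatrix.eq_zero_of_mulVec_eq_zero {n k : ℕ} {U : Matrix (Fin n) (Fin k) ℝ}
    (hU : IsOrthonormalMatrix U) {y : Fin k → ℝ} (hy : U.mulVec y = 0) : y = 0 := by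
  have := congrArg (U.transpose.mulVec) hy
  rwa [Matrix.mulVec_mulVec, hU, Matrix.one_mulVec, Matrix.mulVec_zero] at this

theorem finrank_matRange_fromCols {n k : ℕ} {U A : Matrix (Fin n) (Fin k) ℝ}
    (hU : IsOrthonormalMatrix U)
    (hA : ∀ x y : Fin k → ℝ, A.mulVec x + U.mulVec y = 0 → x = 0) :
    Module.finrank ℝ (matRange (Matrix.fromCols U A)) = 2 * k := by
  rw [finrank_matRange]
  · simp [two_mul]
  · intro z hz
    rw [Matrix.fromCols_mulVec] at hz
    have hx := hA (z ∘ Sum.inr) (z ∘ Sum.inl) (by rw [add_comm]; exact hz)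
    rw [hx, Matrix.mulVec_zero, add_zero] at hz
    have hy := hU.eq_zero_of_mulVec_eq_zero hz
    ext (j | j)
    · exact congrFun hy j
    · exact congrFun hx j

/-! ### Coherence and leverage scores -/

/-- An orthogonal projection is self-adjoint and idempotent. -/
theorem norm_sq_starProjection_single {n : ℕ} (S : Submodule ℝ (EuclideanSpace ℝ (Fin n)))
    (i : Fin n) :
    ‖S.starProjection (EuclideanSpace.single i (1 : ℝ))‖ ^ 2 =
      S.starProjection (EuclideanSpace.single i (1 : ℝ)) i := by
  have h : inner ℝ (S.starProjection (EuclideanSpace.single i (1 : ℝ)))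
      (EuclideanSpace.single i (1 : ℝ)) =
      S.starProjection (EuclideanSpace.single i (1 : ℝ)) i := by
    simp [EuclideanSpace.inner_single_right]
  rw [← h, ← real_inner_self_eq_norm_sq, S.inner_starProjection_left_eq_right,
    S.inner_starProjection_left_eq_right]
  rw [S.starProjection_eq_self_iff.mpr (S.starProjection_apply_mem _)]

theorem norm_sq_starProjection_single_le_one {n : ℕ}
    (S : Submodule ℝ (EuclideanSpace ℝ (Fin n))) (i : Fin n) :
    ‖S.starProjection (EuclideanSpace.single i (1 : ℝ))‖ ^ 2 ≤ 1 := by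
  have h := S.norm_starProjection_apply_le (EuclideanSpace.single i (1 : ℝ))
  rw [PiLp.norm_single, norm_one] at h
  exact pow_le_one₀ (norm_nonneg _) h

theorem subspaceCoherence_nonneg {n : ℕ} (S : Submodule ℝ (EuclideanSpace ℝ (Fin n))) :
    0 ≤ subspaceCoherence S :=
  Real.iSup_nonneg fun _ => by positivity

theorem rhoCoherence_nonneg {n k : ℕ} (G : Matrix (Fin n) (Fin k) ℝ) : 0 ≤ rhoCoherence G :=
  mul_nonneg (by positivity) (Real.iSup_nonneg fun _ => by positivity)

theorem sum_sq_le_rhoCoherence {n k : ℕ} (hk : 1 ≤ k) (G : Matrix (Fin n) (Fin k) ℝ) (i : Fin n) :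
    n / k * ∑ j, G i j ^ 2 ≤ rhoCoherence G := by
  rw [rhoCoherence]
  gcongr
  refine le_trans (le_of_eq ?_)
    (le_ciSup (f := fun i : Fin n => ‖WithLp.toLp 2 (G i)‖ ^ 2) (Set.finite_range _).bddAbove i)
  simp [EuclideanSpace.norm_sq_eq]

/-- The vector `u = UUᵀe_i` lies in the range and pairs with `P e_i` to `‖u‖² = ‖U_i‖²`, so
Cauchy–Schwarz gives `‖u‖ ≤ ‖P e_i‖`. -/
theorem IsOrthonormalMatrix.sum_sq_le_coherence {n k : ℕ} {U : Matrix (Fin n) (Fin k) ℝ}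
    (hU : IsOrthonormalMatrix U) (i : Fin n) :
    n / k * ∑ j, U i j ^ 2 ≤ coherence U := by
  have hfin : Module.finrank ℝ (matRange U) = k := by
    rw [finrank_matRange U fun z => hU.eq_zero_of_mulVec_eq_zero, Fintype.card_fin]
  rw [coherence, subspaceCoherence, hfin]
  refine le_trans ?_ (le_ciSup (f := fun i : Fin n => (n : ℝ) / k *
    ‖(matRange U).starProjection (EuclideanSpace.single i (1 : ℝ))‖ ^ 2)
    (Set.finite_range _).bddAbove i)
  gcongr
  set u : EuclideanSpace ℝ (Fin n) := WithLp.toLp 2 (U.mulVec (U i)) with hu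
  have hmem : u ∈ matRange U := ⟨WithLp.toLp 2 (U i), by simp [Matrix.toLpLin_apply, hu]⟩
  have hnorm : ‖u‖ ^ 2 = ∑ j, U i j ^ 2 := by
    rw [EuclideanSpace.norm_sq_eq, ← hU.sum_mulVec_sq (U i)]
    simp [hu]
  have hinner : inner ℝ u ((matRange U).starProjection (EuclideanSpace.single i (1 : ℝ))) =
      ∑ j, U i j ^ 2 := by
    rw [← (matRange U).inner_starProjection_left_eq_right,
      (matRange U).starProjection_eq_self_iff.mpr hmem, EuclideanSpace.inner_single_right]
    simp [hu, Matrix.mulVec, dotProduct, pow_two]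
  have hcs := real_inner_le_norm u ((matRange U).starProjection (EuclideanSpace.single i (1 : ℝ)))
  rw [hinner, ← hnorm] at hcs
  rw [← hnorm]
  rcases (norm_nonneg u).eq_or_lt with h | h
  · rw [← h, zero_pow two_ne_zero]; positivity
  · gcongr
    nlinarith

/-- Leverage scores of `[U | A]` in terms of the part of `A` orthogonal to `U`. -/
theorem norm_sq_starProjection_fromCols_le {n k : ℕ} {U A : Matrix (Fin n) (Fin k) ℝ}
    (hU : IsOrthonormalMatrix U) {s : ℝ} (hs : 0 < s)
    (hA : ∀ x y : Fin k → ℝ,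
      s ^ 2 * ∑ j, x j ^ 2 ≤ ∑ l, (A.mulVec x l + U.mulVec y l) ^ 2) (i : Fin n) :
    ‖(matRange (Matrix.fromCols U A)).starProjection (EuclideanSpace.single i (1 : ℝ))‖ ^ 2 ≤
      (∑ j, (A - U * (U.transpose * A)) i j ^ 2) / s ^ 2 + ∑ j, U i j ^ 2 := by
  set S := matRange (Matrix.fromCols U A)
  set p := S.starProjection (EuclideanSpace.single i (1 : ℝ)) with hp
  set W := A - U * (U.transpose * A) with hW
  have hpi := norm_sq_starProjection_single S i
  rw [← hp] at hpi
  obtain ⟨z, hz⟩ : p ∈ S := S.starProjection_apply_mem _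
  set x : Fin k → ℝ := z.ofLp ∘ Sum.inr with hx
  set y : Fin k → ℝ := z.ofLp ∘ Sum.inl with hy
  -- Moving `UUᵀAx` into the `U` part makes the decomposition of `p` orthogonal.
  set y' : Fin k → ℝ := y + (U.transpose * A).mulVec x with hy'
  have hdec : ∀ l, p l = W.mulVec x l + U.mulVec y' l := fun l => by
    rw [← hz, Matrix.toLpLin_apply, Matrix.fromCols_mulVec, hW, Matrix.sub_mulVec, hy',
      Matrix.mulVec_add, Matrix.mulVec_mulVec]
    simp [hx, hy, add_comm]
  have hUW : U.transpose * W = 0 := by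
    rw [hW, Matrix.mul_sub, ← Matrix.mul_assoc, hU, Matrix.one_mul, sub_self]
  have horth : ∑ l, W.mulVec x l * U.mulVec y' l = 0 := by
    change W.mulVec x ⬝ᵥ U.mulVec y' = 0
    rw [Matrix.dotProduct_mulVec, ← Matrix.mulVec_transpose, Matrix.mulVec_mulVec, hUW]
    simp
  have hnorm : ‖p‖ ^ 2 = ∑ l, W.mulVec x l ^ 2 + ∑ j, y' j ^ 2 := by
    rw [EuclideanSpace.norm_sq_eq, ← hU.sum_mulVec_sq y']
    calc ∑ l, ‖p l‖ ^ 2 = ∑ l, (W.mulVec x l ^ 2 + U.mulVec y' l ^ 2 +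
          2 * (W.mulVec x l * U.mulVec y' l)) := by
          refine Finset.sum_congr rfl fun l _ => ?_
          rw [Real.norm_eq_abs, sq_abs, hdec]; ring
      _ = _ := by rw [Finset.sum_add_distrib, ← Finset.mul_sum, horth, Finset.sum_add_distrib]; ring
  have hWx : s ^ 2 * ∑ j, x j ^ 2 ≤ ∑ l, W.mulVec x l ^ 2 := by
    refine (hA x (-(U.transpose * A).mulVec x)).trans (le_of_eq ?_)
    refine Finset.sum_congr rfl fun l _ => ?_
    rw [hW, Matrix.sub_mulVec, Matrix.mulVec_neg, Matrix.mulVec_mulVec, Pi.sub_apply, Pi.neg_apply,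
      sub_eq_add_neg]
  -- The weight `s` balances the two blocks: the second factor is at most `‖p‖² = p i`, giving `(p
  -- i)² ≤ R * p i` with `R` the claimed bound.
  have hcs := Finset.sum_mul_sq_le_sq_mul_sq Finset.univ
    (Sum.elim (fun j => W i j / s) (U i)) (Sum.elim (fun j => s * x j) y')
  simp only [Fintype.sum_sum_type, Sum.elim_inl, Sum.elim_inr] at hcs
  have h1 : ∑ j, W i j / s * (s * x j) + ∑ j, U i j * y' j = p i := by
    rw [hdec]
    simp only [Matrix.mulVec, dotProduct]
    congr 1
    refine Finset.sum_congr rfl fun j _ => ?_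
    field_simp
  have h2 : ∑ j, (W i j / s) ^ 2 = (∑ j, W i j ^ 2) / s ^ 2 := by
    rw [Finset.sum_div]
    exact Finset.sum_congr rfl fun j _ => div_pow _ _ _
  have h3 : ∑ j, (s * x j) ^ 2 + ∑ j, y' j ^ 2 ≤ p i := by
    rw [← hpi, hnorm]
    simp only [mul_pow, ← Finset.mul_sum]
    linarith
  rw [h1, h2] at hcs
  rw [hpi]
  have hpos : 0 ≤ p i := hpi ▸ sq_nonneg _
  have hR : 0 ≤ (∑ j, W i j ^ 2) / s ^ 2 + ∑ j, U i j ^ 2 := by positivity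
  have h4 : p i ^ 2 ≤ ((∑ j, W i j ^ 2) / s ^ 2 + ∑ j, U i j ^ 2) * p i :=
    hcs.trans (mul_le_mul_of_nonneg_left h3 hR)
  rcases hpos.eq_or_lt with h | h
  · rw [← h]; exact hR
  · nlinarith

/-! ### Rows of the part of `G + H` orthogonal to `U` -/

/-- The `i`-th row of the orthogonal projection onto the complement of the range of `U`. -/
noncomputable def complementRow {n k : ℕ} (U : Matrix (Fin n) (Fin k) ℝ) (i : Fin n) : Fin n → ℝ :=
  Pi.single i 1 - U.mulVec (U i)

theorem IsOrthonormalMatrix.sum_complementRow_sq_le {n k : ℕ} {U : Matrix (Fin n) (Fin k) ℝ}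
    (hU : IsOrthonormalMatrix U) (i : Fin n) : ∑ l, complementRow U i l ^ 2 ≤ 1 := by
  have h1 : ∑ l, complementRow U i l ^ 2 = 1 - 2 * U.mulVec (U i) i + ∑ l, U.mulVec (U i) l ^ 2 := by
    calc ∑ l, complementRow U i l ^ 2 = ∑ l, ((Pi.single i (1 : ℝ) : Fin n → ℝ) l -
          2 * ((Pi.single i (1 : ℝ) : Fin n → ℝ) l * U.mulVec (U i) l) + U.mulVec (U i) l ^ 2) := by
          refine Finset.sum_congr rfl fun l _ => ?_
          rw [complementRow, Pi.sub_apply]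
          rcases eq_or_ne l i with rfl | h
          · simp; ring
          · simp [h]
      _ = _ := by
          rw [Finset.sum_add_distrib, Finset.sum_sub_distrib, ← Finset.mul_sum]
          simp [Pi.single_apply]
  have h2 : U.mulVec (U i) i = ∑ j, U i j ^ 2 := by simp [Matrix.mulVec, dotProduct, pow_two]
  rw [h1, hU.sum_mulVec_sq, h2]
  have : 0 ≤ ∑ j, U i j ^ 2 := by positivity
  linarith

theorem sum_vecMul_sq_le {n k : ℕ} {G : Matrix (Fin n) (Fin k) ℝ} (hG : ‖G‖ ≤ 1) (v : Fin n → ℝ) :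
    ∑ j, (∑ l, v l * G l j) ^ 2 ≤ ∑ l, v l ^ 2 := by
  have h := Matrix.l2_opNorm_mulVec G.conjTranspose (WithLp.toLp 2 v)
  rw [Matrix.l2_opNorm_conjTranspose] at h
  have h' : ‖(WithLp.toLp 2 (G.conjTranspose.mulVec v) : EuclideanSpace ℝ (Fin k))‖ ≤
      ‖(WithLp.toLp 2 v : EuclideanSpace ℝ (Fin n))‖ :=
    h.trans (mul_le_of_le_one_left (norm_nonneg _) hG)
  have h2 := pow_le_pow_left₀ (norm_nonneg _) h' 2
  rw [EuclideanSpace.norm_sq_eq, EuclideanSpace.norm_sq_eq] at h2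
  simpa [Matrix.mulVec, dotProduct, mul_comm] using h2

theorem abs_apply_le_of_norm_le_one {n k : ℕ} {G : Matrix (Fin n) (Fin k) ℝ} (hG : ‖G‖ ≤ 1)
    (i : Fin n) (j : Fin k) : |G i j| ≤ 1 := by
  have h := sum_vecMul_sq_le hG (Pi.single i 1)
  have h1 : ∑ l, (Pi.single i (1 : ℝ) : Fin n → ℝ) l ^ 2 = 1 := by
    rw [Finset.sum_eq_single i] <;> simp +contextual
  have h2 : ∀ j, ∑ l, (Pi.single i (1 : ℝ) : Fin n → ℝ) l * G l j = G i j := fun j => by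
    simp [Pi.single_apply]
  simp only [h1, h2] at h
  have := Finset.single_le_sum (f := fun j => G i j ^ 2) (fun j _ => sq_nonneg _)
    (Finset.mem_univ j)
  exact (sq_le_one_iff_abs_le_one _).mp (this.trans h)

/-- The row is `G_i - (UU_i)ᵀG` plus the Gaussian term; `‖G‖ ≤ 1` and `‖UU_i‖ = ‖U_i‖` control the
middle part. -/
theorem sum_sub_proj_sq_le {n k : ℕ} {U G H : Matrix (Fin n) (Fin k) ℝ}
    (hU : IsOrthonormalMatrix U) (hG : ‖G‖ ≤ 1) {i : Fin n} {B : ℝ}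
    (hH : ∀ j, (∑ l, complementRow U i l * H l j) ^ 2 ≤ B) :
    ∑ j, ((G + H) - U * (U.transpose * (G + H))) i j ^ 2 ≤
      3 * (∑ j, G i j ^ 2 + ∑ j, U i j ^ 2 + k * B) := by
  have hproj : ∀ j, ((G + H) - U * (U.transpose * (G + H))) i j =
      ∑ l, complementRow U i l * (G + H) l j := fun j => by
    have h1 : (U * (U.transpose * (G + H))) i j = ∑ l, U.mulVec (U i) l * (G + H) l j := by
      rw [← Matrix.mul_assoc, Matrix.mul_apply]
      refine Finset.sum_congr rfl fun l _ => ?_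
      simp [Matrix.mul_apply, Matrix.mulVec, dotProduct, mul_comm]
    rw [Matrix.sub_apply, h1]
    simp [complementRow, sub_mul, Finset.sum_sub_distrib, Pi.single_apply]
  have hsplit : ∀ j, ((G + H) - U * (U.transpose * (G + H))) i j =
      G i j - ∑ l, U.mulVec (U i) l * G l j + ∑ l, complementRow U i l * H l j := fun j => by
    rw [hproj]
    simp only [Matrix.add_apply, mul_add, Finset.sum_add_distrib]
    congr 1
    simp [complementRow, sub_mul, Finset.sum_sub_distrib, Pi.single_apply]
  have hPG : ∑ j, (∑ l, U.mulVec (U i) l * G l j) ^ 2 ≤ ∑ j, U i j ^ 2 := by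
    rw [← hU.sum_mulVec_sq (U i)]
    exact sum_vecMul_sq_le hG _
  calc ∑ j, ((G + H) - U * (U.transpose * (G + H))) i j ^ 2
      ≤ ∑ j, (3 * G i j ^ 2 + 3 * (∑ l, U.mulVec (U i) l * G l j) ^ 2 + 3 * B) := by
        refine Finset.sum_le_sum fun j _ => ?_
        rw [hsplit]
        set a := G i j
        set b := ∑ l, U.mulVec (U i) l * G l j
        have hc := hH j
        set c := ∑ l, complementRow U i l * H l j
        nlinarith [sq_nonneg (a + b), sq_nonneg (a - c), sq_nonneg (b + c)]
    _ = 3 * ∑ j, G i j ^ 2 + 3 * ∑ j, (∑ l, U.mulVec (U i) l * G l j) ^ 2 + 3 * (k * B) := by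
        rw [Finset.sum_add_distrib, Finset.sum_add_distrib, ← Finset.mul_sum, ← Finset.mul_sum]
        simp; ring
    _ ≤ _ := by linarith

/-! ### Deterministic coherence bound -/

theorem exists_orthonormal_basis_matrix_fromCols {n k : ℕ} {U A : Matrix (Fin n) (Fin k) ℝ}
    (hU : IsOrthonormalMatrix U)
    (hA : ∀ x y : Fin k → ℝ, A.mulVec x + U.mulVec y = 0 → x = 0) {B : ℝ}
    (hB : ∀ i, (n : ℝ) / (2 * k) * ‖(matRange (Matrix.fromCols U A)).starProjection
      (EuclideanSpace.single i (1 : ℝ))‖ ^ 2 ≤ B) (hn : 1 ≤ n) :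
    ∃ Q : Matrix (Fin n) (Fin (2 * k)) ℝ, IsOrthonormalMatrix Q ∧
      matRange Q = matRange (Matrix.fromCols U A) ∧ coherence Q ≤ B := by
  have hfin := finrank_matRange_fromCols hU hA
  obtain ⟨Q, hQ, hQr⟩ := exists_isOrthonormalMatrix_of_finrank _ hfin
  refine ⟨Q, hQ, hQr, ?_⟩
  have : Nonempty (Fin n) := ⟨⟨0, hn⟩⟩
  rw [coherence, hQr, subspaceCoherence, hfin]
  refine ciSup_le fun i => ?_
  push_cast
  exact hB i

/-- Homogeneous form of a lower bound over unit vectors. -/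
theorem sq_mul_sum_sq_le_of_unit {n k : ℕ} {A U : Matrix (Fin n) (Fin k) ℝ} {η : ℝ}
    (h : ¬ ∃ x y : Fin k → ℝ, ∑ j, x j ^ 2 = 1 ∧
      ∑ i, (A.mulVec x i + U.mulVec y i) ^ 2 ≤ η ^ 2) (x y : Fin k → ℝ) :
    η ^ 2 * ∑ j, x j ^ 2 ≤ ∑ i, (A.mulVec x i + U.mulVec y i) ^ 2 := by
  have h0 : 0 ≤ ∑ j, x j ^ 2 := by positivity
  rcases h0.eq_or_lt with h1 | h1
  · rw [← h1, mul_zero]; positivity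
  by_contra! hlt
  set r := Real.sqrt (∑ j, x j ^ 2) with hr
  have hr2 : r ^ 2 = ∑ j, x j ^ 2 := Real.sq_sqrt h0
  have hr0 : 0 < r := Real.sqrt_pos.mpr h1
  refine h ⟨r⁻¹ • x, r⁻¹ • y, ?_, ?_⟩
  · simp only [Pi.smul_apply, smul_eq_mul, mul_pow, ← Finset.mul_sum]
    rw [← hr2]; field_simp
  · have : ∀ i, (A.mulVec (r⁻¹ • x) i + U.mulVec (r⁻¹ • y) i) ^ 2 =
        (r ^ 2)⁻¹ * (A.mulVec x i + U.mulVec y i) ^ 2 := fun i => by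
      rw [Matrix.mulVec_smul, Matrix.mulVec_smul, Pi.smul_apply, Pi.smul_apply, smul_eq_mul,
        smul_eq_mul, ← mul_add, mul_pow, inv_pow]
    simp only [this, ← Finset.mul_sum]
    rw [inv_mul_le_iff₀ (by positivity), hr2]
    linarith

theorem eq_zero_of_lower_bound {n k : ℕ} {A U : Matrix (Fin n) (Fin k) ℝ} {η : ℝ} (hη : 0 < η)
    {x y : Fin k → ℝ} (h : η ^ 2 * ∑ j, x j ^ 2 ≤ ∑ i, (A.mulVec x i + U.mulVec y i) ^ 2)
    (hxy : A.mulVec x + U.mulVec y = 0) : x = 0 := by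
  have hz : ∀ i, A.mulVec x i + U.mulVec y i = 0 := fun i => congrFun hxy i
  simp only [hz, zero_pow two_ne_zero, Finset.sum_const_zero] at h
  have h0 : ∑ j, x j ^ 2 = 0 :=
    le_antisymm (nonpos_of_mul_nonpos_right h (by positivity)) (by positivity)
  rw [Finset.sum_eq_zero_iff_of_nonneg fun j _ => sq_nonneg _] at h0
  ext j
  exact (pow_eq_zero_iff two_ne_zero).mp (h0 j (Finset.mem_univ j))

theorem leverage_bound {n k : ℕ} (hn : 1 ≤ n) (hk : 1 ≤ k) {τ : ℝ} (hτ : 0 < τ) (hτ1 : τ < 1)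
    {U G H : Matrix (Fin n) (Fin k) ℝ} (hU : IsOrthonormalMatrix U) (hG : ‖G‖ ≤ 1)
    (hA : ∀ x y : Fin k → ℝ, (τ / 32) ^ 2 * ∑ j, x j ^ 2 ≤
      ∑ l, ((G + H).mulVec x l + U.mulVec y l) ^ 2) (i : Fin n)
    (hH : ∀ j, (∑ l, complementRow U i l * H l j) ^ 2 ≤ 16 * τ ^ 2 * Real.log n / n) :
    (n : ℝ) / (2 * k) * ‖(matRange (Matrix.fromCols U (G + H))).starProjection
      (EuclideanSpace.single i (1 : ℝ))‖ ^ 2 ≤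
      25000 * ((1 / τ ^ 2) * (rhoCoherence G + coherence U + Real.log n)) := by
  have hn' : (0 : ℝ) < n := by exact_mod_cast hn
  have hk' : (0 : ℝ) < k := by exact_mod_cast hk
  have h1 := norm_sq_starProjection_fromCols_le hU (by positivity : 0 < τ / 32) hA i
  have h2 := sum_sub_proj_sq_le hU hG hH
  have hρ := sum_sq_le_rhoCoherence hk G i
  have hμ := hU.sum_sq_le_coherence i
  have hlog : 0 ≤ Real.log n := Real.log_nonneg (by exact_mod_cast hn)
  have hρ0 := rhoCoherence_nonneg G
  have hμ0 : 0 ≤ coherence U := subspaceCoherence_nonneg _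
  set g := ∑ j, G i j ^ 2
  set b := ∑ j, U i j ^ 2
  set ρ := rhoCoherence G
  set μ := coherence U
  have hT : 1 ≤ 1 / τ ^ 2 := by
    rw [one_le_div (by positivity)]; nlinarith
  have hτ2 : τ ^ 2 ≤ 1 := by nlinarith
  calc _ ≤ (n : ℝ) / (2 * k) * (3 * (g + b + k * (16 * τ ^ 2 * Real.log n / n)) / (τ / 32) ^ 2 + b) := by
        gcongr
        refine h1.trans ?_
        gcongr
    -- `1536 = 3 · 32² / 2`; with the factor 16 the logarithm gets 24576, rounded up to 25000.
    _ = 1536 * (1 / τ ^ 2 * (n / k * g + n / k * b + 16 * τ ^ 2 * Real.log n)) +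
          1 / 2 * (n / k * b) := by
        field_simp; ring
    _ ≤ 1536 * (1 / τ ^ 2 * (ρ + μ + 16 * 1 * Real.log n)) + 1 / 2 * (1 / τ ^ 2 * μ) := by
        have := hμ.trans (le_mul_of_one_le_left hμ0 hT)
        have hτlog : 16 * τ ^ 2 * Real.log n ≤ 16 * 1 * Real.log n := by gcongr
        have hin : n / k * g + n / k * b + 16 * τ ^ 2 * Real.log n ≤
            ρ + μ + 16 * 1 * Real.log n := by linarith
        have := mul_le_mul_of_nonneg_left hin (zero_le_one.trans hT)
        linarith
    _ = 1 / τ ^ 2 * (1536 * ρ + 1536.5 * μ + 24576 * Real.log n) := by ring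
    _ ≤ 1 / τ ^ 2 * (25000 * (ρ + μ + Real.log n)) := by
        gcongr; linarith
    _ = _ := by ring

/-! ### Union bounds and almost sure independence -/

theorem IsGaussianMatrix.column_tail {Ω : Type*} [MeasurableSpace Ω] {P : Measure Ω}
    {n k : ℕ} (hn : 1 ≤ n) {τ : ℝ} (hτ : 0 < τ) {H : Ω → Matrix (Fin n) (Fin k) ℝ}
    (hH : IsGaussianMatrix P (τ ^ 2 / n) H) {w : Fin n → ℝ} (hw : ∑ l, w l ^ 2 ≤ 1)
    (j : Fin k) {L : ℝ} (hL : 0 ≤ L) :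
    P {ω | L ≤ |∑ l, w l * H ω l j|} ≤
      ENNReal.ofReal (2 * Real.exp (-(n * L ^ 2 / (2 * τ ^ 2)))) := by
  have hn' : (0 : ℝ) < n := by exact_mod_cast hn
  have hlaw := hasLaw_weighted_sum (fun l => hH.hasLaw l j)
    (hH.indep.precomp (g := fun l => (l, j)) (fun a b hab => by simpa using hab)) w
  have hv : 0 < τ ^ 2 / n := by positivity
  have hs : (((∑ l, w l ^ 2).toNNReal * (τ ^ 2 / n).toNNReal : NNReal) : ℝ) ≤ τ ^ 2 / n := by
    push_cast
    rw [Real.coe_toNNReal _ (by positivity), Real.coe_toNNReal _ hv.le]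
    exact mul_le_of_le_one_left hv.le hw
  refine (gaussian_tail hlaw hs hL).trans (le_of_eq ?_)
  congr 3
  field_simp

/-- Needed twice: with standard basis vectors as `w i` it bounds the entries of `H`, with
`complementRow U` the rows of the projected noise. -/
theorem IsGaussianMatrix.measure_exists_column_tail_le {Ω : Type*} [MeasurableSpace Ω]
    {P : Measure Ω} {n k : ℕ} (hn : 1 ≤ n) (hk : k ≤ n) {τ : ℝ} (hτ : 0 < τ)
    {H : Ω → Matrix (Fin n) (Fin k) ℝ} (hH : IsGaussianMatrix P (τ ^ 2 / n) H)
    {w : Fin n → Fin n → ℝ} (hw : ∀ i, ∑ l, w i l ^ 2 ≤ 1) {L : ℝ} (hL : 0 ≤ L) :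
    P {ω | ∃ i j, L ≤ |∑ l, w i l * H ω l j|} ≤
      ENNReal.ofReal (2 * n ^ 2 * Real.exp (-(n * L ^ 2 / (2 * τ ^ 2)))) := by
  have hset : {ω | ∃ i j, L ≤ |∑ l, w i l * H ω l j|} =
      ⋃ p ∈ (Finset.univ : Finset (Fin n × Fin k)),
        {ω | L ≤ |∑ l, w p.1 l * H ω l p.2|} := by
    ext ω; simp
  rw [hset]
  refine (measure_biUnion_finset_le _ _).trans ((Finset.sum_le_card_nsmul _ _ _ fun p _ =>
    hH.column_tail hn hτ (hw p.1) p.2 hL).trans ?_)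
  rw [nsmul_eq_mul, ← ENNReal.ofReal_natCast, ← ENNReal.ofReal_mul (Nat.cast_nonneg _)]
  apply ENNReal.ofReal_le_ofReal
  have hc : ((Finset.univ : Finset (Fin n × Fin k)).card : ℝ) ≤ n ^ 2 := by
    have : (k : ℝ) ≤ n := by exact_mod_cast hk
    simp only [Finset.card_univ, Fintype.card_prod, Fintype.card_fin]
    push_cast
    nlinarith [Nat.cast_nonneg (α := ℝ) n]
  nlinarith [Real.exp_pos (-(n * L ^ 2 / (2 * τ ^ 2)))]

/-- The columns of `[U | G + H]` are almost surely linearly independent (on bounded entries). -/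
theorem IsGaussianMatrix.measure_dependent_eq_zero {Ω : Type*} [MeasurableSpace Ω] {P : Measure Ω}
    {n k : ℕ} (hn : 1 ≤ n) (hk : 2 * k < n) {τ : ℝ} (hτ : 0 < τ)
    {H : Ω → Matrix (Fin n) (Fin k) ℝ}
    (hH : IsGaussianMatrix P (τ ^ 2 / n) H) {U : Matrix (Fin n) (Fin k) ℝ}
    (hU : IsOrthonormalMatrix U) (G : Matrix (Fin n) (Fin k) ℝ) :
    P {ω | (∀ i j, |(G + H ω) i j| ≤ 2) ∧ ∃ x y : Fin k → ℝ, x ≠ 0 ∧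
        (G + H ω).mulVec x + U.mulVec y = 0} = 0 := by
  set K : ℝ := (44 * n ^ 4) ^ (2 * k) * (8 / τ) ^ n with hK
  have hK0 : 0 ≤ K := by positivity
  have hlim : Tendsto (fun m : ℕ => ENNReal.ofReal (K * (1 / ((m : ℝ) + 1)))) atTop (nhds 0) := by
    rw [← ENNReal.ofReal_zero, ← mul_zero K]
    exact (ENNReal.continuous_ofReal.tendsto _).comp
      (tendsto_one_div_add_atTop_nhds_zero_nat.const_mul K)
  refine le_antisymm (ge_of_tendsto' hlim fun m => ?_) zero_le
  set η : ℝ := 1 / ((m : ℝ) + 1) with hη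
  have hη0 : 0 < η := by positivity
  have hη1 : η ≤ 1 := by
    rw [hη, div_le_one (by positivity)]; linarith [Nat.cast_nonneg (α := ℝ) m]
  refine (measure_mono ?_).trans
    ((hH.measure_small_image_le hn (by omega) hτ hU G hη0 hη1).trans
      (ENNReal.ofReal_le_ofReal ?_))
  · rintro ω ⟨hA, x, y, hx, hxy⟩
    refine ⟨hA, ?_⟩
    by_contra hex
    exact hx (eq_zero_of_lower_bound hη0 (sq_mul_sum_sq_le_of_unit hex x y) hxy)
  -- The net costs `η^(-2k)` against a gain of `η^n`; since `2k < n`, at least one power of `η`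
  -- survives.
  · have hpow : η ^ n = η ^ (2 * k) * η ^ (n - 2 * k) := by
      rw [← pow_add]; congr 1; omega
    have h1 : η ^ (n - 2 * k) ≤ η := pow_le_of_le_one hη0.le hη1 (by omega)
    calc (44 * n ^ 4 / η) ^ (2 * k) * (8 * η / τ) ^ n = K * η ^ (n - 2 * k) := by
          rw [hK, show 8 * η / τ = 8 / τ * η by ring, mul_pow (8 / τ), hpow, div_pow]
          field_simp
      _ ≤ K * η := by gcongr

/-! ### Numerical estimates -/

/-- With `η = τ/32` each net point costs `4^(-n) ≤ exp(-1.3n)`, while the net has at most `n^(12k) ≤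
exp(n/10)` points. The lower bound on `τ` yields `τn ≥ 1`, and `1408 = 44 · 32`, so `44n⁴/η ≤ n⁶`.
-/
theorem net_union_bound_le {n k : ℕ} (hn : 1408 ≤ n) (hk : k * Real.log n ≤ n / 120) {τ : ℝ}
    (hτ : 0 < τ) (hτn : Real.log n ≤ τ ^ 2 * n) :
    (44 * (n : ℝ) ^ 4 / (τ / 32)) ^ (2 * k) * (8 * (τ / 32) / τ) ^ n ≤ Real.exp (-n) := by
  have hn' : (1408 : ℝ) ≤ n := by exact_mod_cast hn
  have hn0 : (0 : ℝ) < n := by linarith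
  have hlog1 : 1 ≤ Real.log n := by
    rw [Real.le_log_iff_exp_le hn0]
    linarith [Real.exp_one_lt_d9]
  have hτ1 : 1 ≤ τ * n := by
    by_contra! h
    have : τ ^ 2 * n * n < 1 := by
      calc τ ^ 2 * n * n = (τ * n) ^ 2 := by ring
        _ < 1 := pow_lt_one₀ (by positivity) h two_ne_zero
    nlinarith
  have h1 : 44 * (n : ℝ) ^ 4 / (τ / 32) ≤ n ^ 6 := by
    rw [div_le_iff₀ (by positivity)]
    calc 44 * (n : ℝ) ^ 4 = 1408 * n ^ 4 / 32 * 1 := by ring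
      _ ≤ n * n ^ 4 / 32 * (τ * n) := by gcongr
      _ = _ := by ring
  have h2 : 8 * (τ / 32) / τ = 1 / 4 := by field_simp; norm_num
  rw [h2]
  have h3 : ((n : ℝ) ^ 6) ^ (2 * k) = Real.exp (12 * (k * Real.log n)) := by
    rw [← pow_mul, ← Real.exp_log hn0, ← Real.exp_nat_mul, Real.exp_log hn0]
    congr 1; push_cast; ring
  have h4 : (1 / 4 : ℝ) ^ n ≤ Real.exp (-(13 / 10)) ^ n := by
    gcongr
    rw [Real.exp_neg, one_div]
    gcongr
    rw [← Real.le_log_iff_exp_le (by norm_num), show (4 : ℝ) = 2 ^ 2 by norm_num, Real.log_pow]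
    have := Real.log_two_gt_d9
    push_cast; linarith
  calc _ ≤ ((n : ℝ) ^ 6) ^ (2 * k) * Real.exp (-(13 / 10)) ^ n := by gcongr
    _ = Real.exp (12 * (k * Real.log n) + n * (-(13 / 10))) := by
        rw [h3, ← Real.exp_nat_mul, Real.exp_add]
    _ ≤ _ := by
        apply Real.exp_le_exp.mpr
        linarith

theorem eventually_tail_terms_le :
    ∀ᶠ n : ℕ in atTop, 2 * (n : ℝ) ^ 2 * Real.exp (-(n / 2)) + 2 * (n : ℝ) ^ 2 * (1 / (n : ℝ) ^ 8)
      ≤ 1 / (n : ℝ) ^ 5 := by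
  -- Power `7 = 2 + 5`, evaluated at `n/2`; the lost factor `2^7` is absorbed by the threshold
  -- `1/1000`.
  have h := (Real.tendsto_pow_mul_exp_neg_atTop_nhds_zero 7).comp
    (tendsto_natCast_atTop_atTop.atTop_div_const (show (0 : ℝ) < 2 by norm_num))
  have h' := h.eventually (gt_mem_nhds (show (0 : ℝ) < 1 / 1000 by norm_num))
  filter_upwards [h', eventually_ge_atTop 4] with n hn hn4
  simp only [Function.comp] at hn
  have hn' : (4 : ℝ) ≤ n := by exact_mod_cast hn4
  have hn0 : (0 : ℝ) < n := by linarith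
  have h1 : (n : ℝ) ^ 7 * Real.exp (-(n / 2)) ≤ 1 / 4 := by
    rw [div_pow] at hn
    linarith
  have h2 : 2 * (n : ℝ) ^ 2 * Real.exp (-(n / 2)) ≤ 1 / 2 / (n : ℝ) ^ 5 := by
    rw [le_div_iff₀ (by positivity)]
    calc _ = 2 * ((n : ℝ) ^ 7 * Real.exp (-(n / 2))) := by ring
      _ ≤ _ := by linarith
  have h3 : 2 * (n : ℝ) ^ 2 * (1 / (n : ℝ) ^ 8) ≤ 1 / 2 / (n : ℝ) ^ 5 := by
    rw [le_div_iff₀ (by positivity)]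
    calc _ = 2 / (n : ℝ) := by field_simp
      _ ≤ _ := by rw [div_le_iff₀ hn0]; linarith
  calc _ ≤ 1 / 2 / (n : ℝ) ^ 5 + 1 / 2 / (n : ℝ) ^ 5 := add_le_add h2 h3
    _ = _ := by ring

/-! ### The main theorem -/

/-- The probability is bounded through the failure event: `P` of a possibly non-measurable set is
its outer measure, so this says that a measurable event of probability at least
`1 - exp (-c n) - n⁻⁵` is contained in the success event. The norm of `G` is the spectral norm. -/
theorem mainTheorem8 :
    ∃ C c : ℝ, 0 < C ∧ 0 < c ∧
      ∀ k : ℕ → ℕ, (∀ n, 1 ≤ k n) →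
        (fun n : ℕ => (k n : ℝ)) =o[atTop] (fun n : ℕ => (n : ℝ) / Real.log (n : ℝ)) →
        ∀ᶠ n : ℕ in atTop,
          ∀ τ : ℝ, 0 < τ → τ < 1 →
          ∀ U G : Matrix (Fin n) (Fin (k n)) ℝ, IsOrthonormalMatrix U → ‖G‖ ≤ 1 →
          ∀ (Ω : Type*) [MeasurableSpace Ω] (P : Measure Ω) [IsProbabilityMeasure P]
            (H : Ω → Matrix (Fin n) (Fin (k n)) ℝ), IsGaussianMatrix P (τ ^ 2 / (n : ℝ)) H →
            P {ω | ¬ ∃ Q : Matrix (Fin n) (Fin (2 * k n)) ℝ,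
                IsOrthonormalMatrix Q ∧
                matRange Q = matRange (Matrix.fromCols U (G + H ω)) ∧
                coherence Q ≤
                  C * ((1 / τ ^ 2) * (rhoCoherence G + coherence U + Real.log (n : ℝ)))} ≤
              ENNReal.ofReal (Real.exp (-(c * (n : ℝ))) + 1 / (n : ℝ) ^ 5) := by
  refine ⟨25000, 1, by norm_num, one_pos, fun k hk1 hko => ?_⟩
  filter_upwards [hko.bound (show (0 : ℝ) < 1 / 120 by norm_num), eventually_tail_terms_le,
    eventually_ge_atTop 1408] with n hkn htail hn1408
  intro τ hτ hτ1 U G hU hG Ω _ P _ H hH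
  have hn1 : 1 ≤ n := by omega
  have hn' : (1408 : ℝ) ≤ n := by exact_mod_cast hn1408
  have hn0 : (0 : ℝ) < n := by linarith
  have hk' : (1 : ℝ) ≤ k n := by exact_mod_cast hk1 n
  have hlog1 : 1 ≤ Real.log n := by
    rw [Real.le_log_iff_exp_le hn0]
    linarith [Real.exp_one_lt_d9]
  have hklog : k n * Real.log n ≤ n / 120 := by
    rw [Real.norm_of_nonneg (by positivity), Real.norm_of_nonneg (by positivity),
      ← mul_div_assoc, le_div_iff₀ (by linarith)] at hkn
    linarith
  have h2k : 2 * k n < n := by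
    have : (2 * k n : ℝ) < n := by nlinarith
    exact_mod_cast this
  have hG1 := abs_apply_le_of_norm_le_one hG
  have hentry : ∀ ω, (¬ ∃ i j, 1 ≤ |∑ l, (Pi.single i 1 : Fin n → ℝ) l * H ω l j|) →
      ∀ i j, |(G + H ω) i j| ≤ 2 := fun ω h i j => by
    push Not at h
    have h1 := h i j
    simp only [Pi.single_apply, ite_mul, one_mul, zero_mul, Finset.sum_ite_eq', Finset.mem_univ,
      if_true] at h1
    rw [Matrix.add_apply]
    exact (abs_add_le _ _).trans (by linarith [hG1 i j])
  have hE1 : P {ω | ∃ i j, 1 ≤ |∑ l, (Pi.single i 1 : Fin n → ℝ) l * H ω l j|} ≤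
      ENNReal.ofReal (2 * (n : ℝ) ^ 2 * Real.exp (-(n / 2))) := by
    refine (hH.measure_exists_column_tail_le hn1 (by omega) hτ (w := fun i => Pi.single i 1)
      (fun i => ?_) zero_le_one).trans (ENNReal.ofReal_le_ofReal ?_)
    · rw [Finset.sum_eq_single i] <;> simp +contextual
    · have : τ ^ 2 ≤ 1 := by nlinarith
      have : (n : ℝ) / 2 ≤ n * 1 ^ 2 / (2 * τ ^ 2) := by
        rw [le_div_iff₀ (by positivity)]
        nlinarith
      gcongr
  have hpow8 : 0 ≤ 2 * (n : ℝ) ^ 2 * (1 / (n : ℝ) ^ 8) := by positivity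
  have hρ0 := rhoCoherence_nonneg G
  have hμ0 : 0 ≤ coherence U := subspaceCoherence_nonneg _
  rw [one_mul]
  -- For larger `τ` the net argument applies; for smaller `τ` the claimed bound exceeds the trivial
  -- one.
  rcases le_or_gt (Real.log n) (τ ^ 2 * n) with hcase | hcase
  -- This makes the Gaussian tail exactly `2n^(-8)`, enough to absorb the `n²` pairs and leave
  -- `n^(-5)`.
  · set L : ℝ := Real.sqrt (16 * τ ^ 2 * Real.log n / n) with hL
    have hL2 : L ^ 2 = 16 * τ ^ 2 * Real.log n / n := Real.sq_sqrt (by positivity)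
    have hE2 : P {ω | ∃ i j, L ≤ |∑ l, complementRow U i l * H ω l j|} ≤
        ENNReal.ofReal (2 * (n : ℝ) ^ 2 * (1 / (n : ℝ) ^ 8)) := by
      refine (hH.measure_exists_column_tail_le hn1 (by omega) hτ hU.sum_complementRow_sq_le
        (Real.sqrt_nonneg _)).trans (ENNReal.ofReal_le_ofReal (le_of_eq ?_))
      congr 1
      have : n * L ^ 2 / (2 * τ ^ 2) = (8 : ℕ) * Real.log n := by
        rw [hL2]; field_simp; norm_num
      rw [← hL, this, Real.exp_neg, Real.exp_nat_mul, Real.exp_log hn0, one_div]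
    have hE3 := (hH.measure_small_image_le hn1 (by omega) hτ hU G (η := τ / 32) (by positivity)
      (by linarith)).trans (ENNReal.ofReal_le_ofReal
        (net_union_bound_le hn1408 hklog hτ hcase))
    refine (measure_mono ?_).trans ((measure_union_le _ _).trans
      ((add_le_add ((measure_union_le _ _).trans (add_le_add hE1 hE2)) hE3).trans ?_))
    · intro ω hω
      by_contra hnot
      simp only [Set.mem_union, not_or] at hnot
      obtain ⟨⟨h1, h2⟩, h3⟩ := hnot
      have hlow := sq_mul_sum_sq_le_of_unit fun hex => h3 ⟨hentry ω h1, hex⟩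
      refine hω (exists_orthonormal_basis_matrix_fromCols hU (fun x y hxy => ?_)
        (fun i => leverage_bound hn1 (hk1 n) hτ hτ1 hU hG hlow i fun j => ?_) hn1)
      · exact eq_zero_of_lower_bound (by positivity) (hlow x y) hxy
      · rw [← hL2]
        have : |∑ l, complementRow U i l * H ω l j| < L := by
          by_contra! h
          exact h2 ⟨i, j, h⟩
        exact sq_le_sq.mpr (this.le.trans (le_abs_self _))
    · rw [← ENNReal.ofReal_add (by positivity) hpow8,
        ← ENNReal.ofReal_add (by positivity) (Real.exp_pos _).le]
      apply ENNReal.ofReal_le_ofReal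
      linarith
  · have hE0 := hH.measure_dependent_eq_zero hn1 h2k hτ hU G
    refine (measure_mono ?_).trans ((measure_union_le _ _).trans
      ((add_le_add hE1 hE0.le).trans ?_))
    · intro ω hω
      by_contra hnot
      simp only [Set.mem_union, not_or] at hnot
      obtain ⟨h1, h3⟩ := hnot
      refine hω (exists_orthonormal_basis_matrix_fromCols hU (fun x y hxy => ?_)
        (fun i => ?_) hn1)
      · by_contra hx
        exact h3 ⟨hentry ω h1, x, y, hx, hxy⟩
      · have hp := norm_sq_starProjection_single_le_one
          (matRange (Matrix.fromCols U (G + H ω))) i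
        have hT : (n : ℝ) ≤ 1 / τ ^ 2 * Real.log n := by
          rw [one_div, inv_mul_eq_div, le_div_iff₀ (by positivity)]
          linarith
        calc _ ≤ (n : ℝ) / (2 * k n) * 1 := by gcongr
          _ ≤ n := by
            rw [mul_one, div_le_iff₀ (by positivity)]; nlinarith
          _ ≤ 1 / τ ^ 2 * Real.log n := hT
          _ ≤ 25000 * (1 / τ ^ 2 * Real.log n) := by nlinarith
          _ ≤ _ := by gcongr; linarith
    · rw [add_zero]
      apply ENNReal.ofReal_le_ofReal
      linarith [Real.exp_pos (-(n : ℝ))]
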